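/- Let $W$ denote the principal branch of the Lambert function; for real $x\ge 0$, $W(x)$ is the unique $w\ge -1$ with $we^{w}=x$. For $\tau>0$ and $\sigma\ge 1$ put $M^{\tau,\sigma}_0=1$ and $M^{\tau,\sigma}_p=p^{\tau p^{\sigma}}$ for $p\ge 1$, and let $\mathcal{E}_{\tau,\sigma}(\mathbb{R})$ be the set of all $\phi\in C^\infty(\mathbb{R})$ such that for every compact $K\subset\mathbb{R}$ there is $C>0$ with $$\sup_{x\in K}|\phi^{(p)}(x)|\le C^{p^{\sigma}+1}M^{\tau,\sigma}_p\qquad\text{for all } p\in\mathbb{N}_0 .$$ For $\sigma>1$ let $\mathcal{E}_\sigma(\mathbb{R})=\bigcup_{\tau>0}\mathcal{E}_{\tau,\sigma}(\mathbb{R})$, and for $t>1$ let $\mathcal{G}_t(\mathbb{R})=\mathcal{E}_{t,1}(\mathbb{R})$ be the classical Gevrey class of order $t$. For $\sigma>1$ and $\rho>0$ define $$\omega_\sigma(x)=\frac{x^{\sigma/(\sigma-1)}}{W(x)^{1/(\sigma-1)}}\ (x>0),\qquad \omega_\sigma(0)=0,\qquad g_\sigma(x)=\omega_\sigma(\ln(1+|x|))\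 (x\in\mathbb{R}),$$ $$f_{\rho,\sigma}(x)=e^{-\rho g_\sigma(1/x)}\ (x\ne 0),\qquad f_{\rho,\sigma}(0)=0 .$$ Then for every $\sigma>1$ and every $\rho>0$ $$f_{\rho,\sigma}\in\mathcal{E}_\sigma(\mathbb{R})\setminus\bigcup_{1<\sigma'<\sigma}\mathcal{E}_{\sigma'}(\mathbb{R}),\qquad\text{and}\qquad f_{\rho,\sigma}\notin\bigcup_{t>1}\mathcal{G}_t(\mathbb{R}).$$ -/

import Mathlib

open scoped ContDiff

namespace ExtendedGevrey

/-- The principal branch of the Lambert `W` function on the real half-line `[-1/e, ∞)`: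
`lambertW x` is the unique `w ≥ -1` with `w * exp w = x` (see `lambertW_spec`,
`eq_lambertW`). Outside that half-line the value carries no meaning and is never used. -/
noncomputable def lambertW (x : ℝ) : ℝ :=
  Function.invFunOn (fun w : ℝ => w * Real.exp w) (Set.Ici (-1)) x

theorem strictMonoOn_mul_exp :
    StrictMonoOn (fun w : ℝ => w * Real.exp w) (Set.Ici (-1)) := by
  have hd : ∀ w : ℝ, HasDerivAt (fun w : ℝ => w * Real.exp w)
      (1 * Real.exp w + w * Real.exp w) w := fun w =>
    (hasDerivAt_id w).mul (Real.hasDerivAt_exp w)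
  refine strictMonoOn_of_deriv_pos (convex_Ici _) (by fun_prop) fun w hw => ?_
  rw [interior_Ici, Set.mem_Ioi] at hw
  rw [(hd w).deriv, ← add_mul]
  exact mul_pos (by linarith) (Real.exp_pos w)

theorem lambertW_spec {x : ℝ} (hx : -Real.exp (-1) ≤ x) :
    -1 ≤ lambertW x ∧ lambertW x * Real.exp (lambertW x) = x := by
  have h : ∃ w ∈ Set.Ici (-1 : ℝ), (fun w : ℝ => w * Real.exp w) w = x := by
    have hb : (-1 : ℝ) ≤ max x 0 := le_trans (by norm_num) (le_max_right x 0)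
    have hc : ContinuousOn (fun w : ℝ => w * Real.exp w) (Set.Icc (-1) (max x 0)) := by
      fun_prop
    have hmem : x ∈ Set.Icc ((fun w : ℝ => w * Real.exp w) (-1))
        ((fun w : ℝ => w * Real.exp w) (max x 0)) := by
      constructor
      · simpa using hx
      · have h1 : 1 ≤ Real.exp (max x 0) := Real.one_le_exp (le_max_right _ _)
        have h0 : 0 ≤ max x 0 := le_max_right _ _
        have h2 : x ≤ max x 0 := le_max_left _ _
        show x ≤ max x 0 * Real.exp (max x 0)
        nlinarith
    obtain ⟨w, hw, hwx⟩ := intermediate_value_Icc hb hc hmem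
    exact ⟨w, hw.1, hwx⟩
  exact ⟨Function.invFunOn_mem h, Function.invFunOn_eq h⟩

theorem eq_lambertW {x w : ℝ} (hw : -1 ≤ w) (hx : w * Real.exp w = x) :
    w = lambertW x := by
  have h : -Real.exp (-1) ≤ x := by
    have := strictMonoOn_mul_exp.monotoneOn (Set.mem_Ici.2 le_rfl) (Set.mem_Ici.2 hw) hw
    simp only [hx] at this
    linarith
  have hs := lambertW_spec h
  exact strictMonoOn_mul_exp.injOn (Set.mem_Ici.2 hw) (Set.mem_Ici.2 hs.1)
    (hx.trans hs.2.symm)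

/-- `ω_σ(x) = x ^ (σ/(σ-1)) / W(x) ^ (1/(σ-1))` for `x ≥ 0`, with `ω_σ(0) = 0`
(see `omega_zero`). -/
noncomputable def omega (σ x : ℝ) : ℝ :=
  x ^ (σ / (σ - 1)) / lambertW x ^ (1 / (σ - 1))

theorem omega_zero {σ : ℝ} (hσ : 1 < σ) : omega σ 0 = 0 := by
  have h : σ / (σ - 1) ≠ 0 := (div_pos (by linarith) (by linarith)).ne'
  simp [omega, Real.zero_rpow h]

/-- `g_σ(x) = ω_σ(ln(1 + |x|))`. -/
noncomputable def g (σ x : ℝ) : ℝ := omega σ (Real.log (1 + |x|))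

/-- `f_{ρ,σ}(x) = exp(-ρ g_σ(1/x))` for `x ≠ 0`, and `f_{ρ,σ}(0) = 0`, the limit at `0`. -/
noncomputable def f (ρ σ x : ℝ) : ℝ :=
  if x = 0 then 0 else Real.exp (-ρ * g σ (1 / x))

/-- The defining sequence `M_p^{τ,σ} = p ^ (τ p^σ)` for `p ≥ 1`, with `M_0^{τ,σ} = 1`. -/
noncomputable def M (τ σ : ℝ) (p : ℕ) : ℝ :=
  if p = 0 then 1 else (p : ℝ) ^ (τ * (p : ℝ) ^ σ)

/-- The class `ℰ_{τ,σ}(ℝ)`: smooth functions whose derivatives satisfy, on every compact set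
`K`, the bounds `sup_K |φ^(p)| ≤ C ^ (p^σ + 1) * M_p^{τ,σ}` for all `p`, with `C = C(K) > 0`. -/
def classTauSigma (τ σ : ℝ) : Set (ℝ → ℝ) :=
  {φ | ContDiff ℝ ∞ φ ∧ ∀ K : Set ℝ, IsCompact K → ∃ C : ℝ, 0 < C ∧
    ∀ p : ℕ, ∀ x ∈ K, |iteratedDeriv p φ x| ≤ C ^ ((p : ℝ) ^ σ + 1) * M τ σ p}

/-- The extended Gevrey class `ℰ_σ(ℝ) = ⋃_{τ > 0} ℰ_{τ,σ}(ℝ)`. -/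
def classSigma (σ : ℝ) : Set (ℝ → ℝ) := ⋃ τ ∈ Set.Ioi (0 : ℝ), classTauSigma τ σ

/-- The classical Gevrey class `𝒢_t(ℝ)` of order `t`: on every compact set
`|φ^(p)| ≤ C ^ (p + 1) * p ^ (t p)`. -/
def gevreyClass (t : ℝ) : Set (ℝ → ℝ) := classTauSigma t 1

end ExtendedGevrey

open Filter Topology

namespace ExtendedGevrey

/-! ### The Lambert function and the weight `omega` -/

/-! Write `Y = ln(1+1/|x|)`, `u = W(Y)`, `λ = σ/(σ-1)`, so that `f = exp(-ρ ω(Y))` with `ω(Y) = u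
e^{λu} = Y e^{u/(σ-1)}`.

Membership: off the origin, `f` has its logarithmic derivative in a differential algebra with seven
generators, all bounded by `e^{λY}`. Hence `f^(p)` is `f` times a polynomial of degree at most `8p`
in the generators with coefficient sum at most `(9N)^p p!` (`ctrl_iteratedDeriv_f`), and `|f^(p)| ≤
(9N)^p p! exp(8pλY - ρω(Y))`. The Legendre bound `mul_sub_omega_le` turns the exponential into
`exp(O(p^σ ln p) + O(p^σ))`. The same bound makes every such expression `O(x²)`, hence flat at `0`,
which gives smoothness there.

Sharpness: for `f` in `ℰ_{τ,σ'}`, flatness and Taylor's estimate give `p Y ≤ ρω(Y) + O(p^{σ'} ln p)`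
for small `x > 0`. At a `Y` of size about `p^{σ-1} ln p` the left side exceeds `ρω(Y)` by a multiple
of `p^σ ln p`, which is impossible for `σ' < σ`. The case `σ' = 1` is the Gevrey one. -/

theorem lambertW_mul_exp {w : ℝ} (hw : -1 ≤ w) : lambertW (w * Real.exp w) = w :=
  (eq_lambertW hw rfl).symm

theorem neg_exp_le_of_nonneg {x : ℝ} (hx : 0 ≤ x) : -Real.exp (-1) ≤ x := by
  linarith [Real.exp_pos (-1)]

theorem lambertW_mul_exp_self {x : ℝ} (hx : 0 ≤ x) :
    lambertW x * Real.exp (lambertW x) = x :=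
  (lambertW_spec (neg_exp_le_of_nonneg hx)).2

theorem lambertW_pos {x : ℝ} (hx : 0 < x) : 0 < lambertW x :=
  pos_of_mul_pos_left ((lambertW_mul_exp_self hx.le).symm ▸ hx) (Real.exp_pos _).le

theorem lambertW_le_self {x : ℝ} (hx : 0 < x) : lambertW x ≤ x := by
  have h := lambertW_mul_exp_self hx.le
  have h0 := lambertW_pos hx
  have h1 := Real.one_le_exp h0.le
  nlinarith

theorem monotoneOn_lambertW : MonotoneOn lambertW (Set.Ioi 0) := by
  intro x hx y hy hxy
  have h1 := lambertW_mul_exp_self (le_of_lt hx)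
  have h2 := lambertW_mul_exp_self (le_of_lt hy)
  have h3 := lambertW_pos hx
  have h4 := lambertW_pos hy
  refine (strictMonoOn_mul_exp.le_iff_le (a := lambertW x) (b := lambertW y)
    ?_ ?_).1 ?_
  · exact Set.mem_Ici.2 (by linarith)
  · exact Set.mem_Ici.2 (by linarith)
  · simpa only [h1, h2] using hxy

theorem continuousAt_lambertW {x : ℝ} (hx : 0 < x) : ContinuousAt lambertW x := by
  refine continuousAt_of_monotoneOn_of_image_mem_nhds monotoneOn_lambertW (Ioi_mem_nhds hx) ?_
  refine mem_of_superset (Ioi_mem_nhds (lambertW_pos hx)) fun w hw => ?_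
  rw [Set.mem_Ioi] at hw
  exact ⟨w * Real.exp w, mul_pos hw (Real.exp_pos w), lambertW_mul_exp (by linarith)⟩

theorem hasDerivAt_lambertW {x : ℝ} (hx : 0 < x) :
    HasDerivAt lambertW (Real.exp (-lambertW x) * (1 + lambertW x)⁻¹) x := by
  have hw := lambertW_pos hx
  have hd : HasDerivAt (fun w : ℝ => w * Real.exp w)
      (1 * Real.exp (lambertW x) + lambertW x * Real.exp (lambertW x)) (lambertW x) :=
    (hasDerivAt_id _).mul (Real.hasDerivAt_exp _)
  have h := HasDerivAt.of_local_left_inverse (continuousAt_lambertW hx) hd (by positivity)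
    ((eventually_gt_nhds hx).mono fun y hy => lambertW_mul_exp_self hy.le)
  refine h.congr_deriv ?_
  rw [Real.exp_neg, ← add_mul, mul_inv, mul_comm]

/-- The substitution `y = w e^w` eliminates `W`. -/
theorem omega_mul_exp {σ w : ℝ} (hσ : 1 < σ) (hw : 0 < w) :
    omega σ (w * Real.exp w) = w * Real.exp (σ / (σ - 1) * w) := by
  have h1 : σ - 1 ≠ 0 := by linarith
  rw [omega, lambertW_mul_exp (by linarith), Real.mul_rpow hw.le (Real.exp_pos w).le,
    ← Real.exp_mul, mul_comm w (σ / (σ - 1)), mul_comm, mul_div_assoc, ← Real.rpow_sub hw, mul_comm]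
  congr 1
  rw [← sub_div, div_self h1, Real.rpow_one]

theorem omega_eq {σ y : ℝ} (hσ : 1 < σ) (hy : 0 < y) :
    omega σ y = lambertW y * Real.exp (σ / (σ - 1) * lambertW y) := by
  rw [← omega_mul_exp hσ (lambertW_pos hy), lambertW_mul_exp_self hy.le]

theorem omega_eq_mul_exp {σ y : ℝ} (hσ : 1 < σ) (hy : 0 < y) :
    omega σ y = y * Real.exp (lambertW y / (σ - 1)) := by
  have h1 : σ - 1 ≠ 0 := by linarith
  have h2 : σ / (σ - 1) * lambertW y = lambertW y + lambertW y / (σ - 1) := by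
    field_simp; ring
  rw [omega_eq hσ hy, h2, Real.exp_add, ← mul_assoc, lambertW_mul_exp_self hy.le]

/-- A Legendre-type bound for `omega`. -/
theorem mul_sub_omega_le {σ ρ n y : ℝ} (hσ : 1 < σ) (hρ : 0 < ρ) (hn : 0 < n) (hy : 0 < y) :
    n * y - ρ * omega σ y ≤ max 0 ((σ - 1) * ρ * (n / ρ) ^ σ * Real.log (n / ρ)) := by
  have hs : 0 < σ - 1 := by linarith
  have hW := lambertW_pos hy
  have hr : 0 < n / ρ := div_pos hn hρ
  rw [omega_eq_mul_exp hσ hy]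
  -- The difference is `y (n - ρ e^{W(y)/(σ-1)})`. Either it is nonpositive, or `W(y)` is bounded,
  -- hence so is `y = W e^W`, and the `omega` term can be dropped.
  by_cases h : n / ρ ≤ Real.exp (lambertW y / (σ - 1))
  · refine le_max_of_le_left ?_
    rw [div_le_iff₀ hρ] at h
    nlinarith [mul_le_mul_of_nonneg_right h hy.le]
  · refine le_max_of_le_right ?_
    push Not at h
    have h1 : lambertW y ≤ (σ - 1) * Real.log (n / ρ) := by
      have := (Real.lt_log_iff_exp_lt hr).2 h
      rw [div_lt_iff₀ hs] at this
      linarith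
    have h2 : y ≤ (σ - 1) * Real.log (n / ρ) * (n / ρ) ^ (σ - 1) := by
      calc y = lambertW y * Real.exp (lambertW y) := (lambertW_mul_exp_self hy.le).symm
        _ ≤ ((σ - 1) * Real.log (n / ρ)) * Real.exp ((σ - 1) * Real.log (n / ρ)) := by
          gcongr
          exact hW.le.trans h1
        _ = _ := by rw [Real.rpow_def_of_pos hr, mul_comm (Real.log (n / ρ)) (σ - 1)]
    have h3 : (n / ρ) ^ σ = (n / ρ) ^ (σ - 1) * (n / ρ) := by
      rw [← Real.rpow_add_one hr.ne']; ring_nf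
    have h4 : n * y ≤ n * ((σ - 1) * Real.log (n / ρ) * (n / ρ) ^ (σ - 1)) := by gcongr
    have h5 : (σ - 1) * ρ * (n / ρ) ^ σ * Real.log (n / ρ)
        = n * ((σ - 1) * Real.log (n / ρ) * (n / ρ) ^ (σ - 1)) := by
      rw [h3]; field_simp
    rw [h5]
    have : 0 ≤ ρ * (y * Real.exp (lambertW y / (σ - 1))) := by positivity
    linarith

/-! ### Differential polynomials with controlled degree and coefficients -/

/-- `Ctrl 𝒳 φ m B F`: the function `F` is `φ` times a polynomial expression in the functions
in `𝒳`, of degree at most `m` and with sum of absolute values of coefficients at most `B`. -/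
inductive Ctrl (𝒳 : Set (ℝ → ℝ)) (φ : ℝ → ℝ) : ℕ → ℝ → (ℝ → ℝ) → Prop
  | base : Ctrl 𝒳 φ 0 1 φ
  | mul {m B X F} : X ∈ 𝒳 → Ctrl 𝒳 φ m B F → Ctrl 𝒳 φ (m + 1) B (X * F)
  | add {m B B' F F'} : Ctrl 𝒳 φ m B F → Ctrl 𝒳 φ m B' F' → Ctrl 𝒳 φ m (B + B') (F + F')
  | smul {m B F} (c : ℝ) : Ctrl 𝒳 φ m B F → Ctrl 𝒳 φ m (|c| * B) (c • F)
  | mono {m m' B B' F} : m ≤ m' → B ≤ B' → Ctrl 𝒳 φ m B F → Ctrl 𝒳 φ m' B' F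

namespace Ctrl

variable {𝒳 : Set (ℝ → ℝ)} {φ : ℝ → ℝ} {m m' : ℕ} {B B' : ℝ} {F Z : ℝ → ℝ}

theorem nonneg (h : Ctrl 𝒳 φ m B F) : 0 ≤ B := by
  induction h with
  | base => exact zero_le_one
  | mul _ _ ih => exact ih
  | add _ _ ih ih' => exact add_nonneg ih ih'
  | smul c _ ih => exact mul_nonneg (abs_nonneg c) ih
  | mono _ hB _ ih => exact ih.trans hB

theorem mul_left (hZ : Ctrl 𝒳 1 m B Z) (hF : Ctrl 𝒳 φ m' B' F) :
    Ctrl 𝒳 φ (m + m') (B * B') (Z * F) := by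
  induction hZ with
  | base => simpa using hF
  | mul hX _ ih => rw [mul_assoc]; exact (ih.mul hX).mono (by omega) le_rfl
  | add _ _ ih ih' => rw [add_mul, add_mul]; exact ih.add ih'
  | smul c _ ih => rw [smul_mul_assoc, mul_assoc]; exact ih.smul c
  | mono hm hB _ ih =>
    exact ih.mono (by omega) (mul_le_mul_of_nonneg_right hB hF.nonneg)

/-- Every term keeps the factor `φ`; with `φ = f` this makes all derivatives vanish at `0`. -/
theorem eq_zero (h : Ctrl 𝒳 φ m B F) {x : ℝ} (hx : φ x = 0) : F x = 0 := by
  induction h with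
  | base => exact hx
  | mul _ _ ih => simp [ih]
  | add _ _ ih ih' => simp [ih, ih']
  | smul c _ ih => simp [ih]
  | mono _ _ _ ih => exact ih

theorem abs_le (h : Ctrl 𝒳 φ m B F) {x G : ℝ} (hG : 1 ≤ G) (hX : ∀ X ∈ 𝒳, |X x| ≤ G) :
    |F x| ≤ B * G ^ m * |φ x| := by
  have hG0 : 0 ≤ G := zero_le_one.trans hG
  induction h with
  | base => simp
  | @mul m B X F hm _ ih =>
    rw [Pi.mul_apply, abs_mul]
    calc |X x| * |F x| ≤ G * (B * G ^ m * |φ x|) := by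
          gcongr
          exact hX _ hm
      _ = _ := by ring
  | @add m B B' F F' _ _ ih ih' =>
    rw [Pi.add_apply]
    calc |F x + F' x| ≤ |F x| + |F' x| := abs_add_le _ _
      _ ≤ B * G ^ m * |φ x| + B' * G ^ m * |φ x| := add_le_add ih ih'
      _ = _ := by ring
  | @smul m B F c _ ih =>
    rw [Pi.smul_apply, smul_eq_mul, abs_mul]
    calc |c| * |F x| ≤ |c| * (B * G ^ m * |φ x|) := by gcongr
      _ = _ := by ring
  | @mono m m' B B' F hm hB h ih =>
    have := h.nonneg
    refine ih.trans ?_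
    gcongr
    exact this.trans hB

/-- If the derivatives of the functions in `𝒳`, and the logarithmic derivative of `φ`, are
polynomials in `𝒳` of degree at most `d` and coefficient sum at most `N`, then the class of
controlled functions is stable under differentiation. -/
theorem exists_hasDerivAt {S : Set ℝ} {d : ℕ} {N : ℝ}
    (h𝒳 : ∀ X ∈ 𝒳, ∃ Z, Ctrl 𝒳 1 d N Z ∧ ∀ x ∈ S, HasDerivAt X (Z x) x)
    {L : ℝ → ℝ} (hL : Ctrl 𝒳 1 d N L) (hφ : ∀ x ∈ S, HasDerivAt φ (L x * φ x) x)
    (h : Ctrl 𝒳 φ m B F) :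
    ∃ F', Ctrl 𝒳 φ (m + d) (N * (m + 1) * B) F' ∧ ∀ x ∈ S, HasDerivAt F (F' x) x := by
  have hN := hL.nonneg
  induction h with
  | base =>
    exact ⟨L * φ, (hL.mul_left base).mono (by omega) (by simp), hφ⟩
  | @mul m B X F hX hF ih =>
    obtain ⟨F', hF', hd⟩ := ih
    obtain ⟨Z, hZ, hZd⟩ := h𝒳 X hX
    refine ⟨Z * F + X * F', ?_, fun x hx => (hZd x hx).mul (hd x hx)⟩
    -- Leibniz: `Z * F` costs `N B` and `X * F'` costs `N (m+1) B`, together `N (m+2) B`.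
    refine mono le_rfl ?_ (add (mono (m' := m + 1 + d) (by omega) le_rfl (hZ.mul_left hF))
      (mono (m' := m + 1 + d) (by omega) le_rfl (hF'.mul hX)))
    push_cast
    linarith
  | @add m B B' F G _ _ ih ih' =>
    obtain ⟨F', hF', hd⟩ := ih
    obtain ⟨G', hG', hd'⟩ := ih'
    exact ⟨F' + G', (hF'.add hG').mono le_rfl (by linarith),
      fun x hx => (hd x hx).add (hd' x hx)⟩
  | @smul m B F c _ ih =>
    obtain ⟨F', hF', hd⟩ := ih
    exact ⟨c • F', (hF'.smul c).mono le_rfl (by linarith),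
      fun x hx => (hd x hx).const_smul c⟩
  | @mono m m' B B' F hm hB hF ih =>
    obtain ⟨F', hF', hd⟩ := ih
    have := hF.nonneg
    exact ⟨F', hF'.mono (by omega) (by gcongr), hd⟩

end Ctrl

/-! ### The differential algebra generated by `f` -/

/-- `ln(1 + |1/x|)`. -/
noncomputable def logInv (x : ℝ) : ℝ := Real.log (1 + |x⁻¹|)

/-- `W(ln(1 + |1/x|))`. -/
noncomputable def lambertLogInv (x : ℝ) : ℝ := lambertW (logInv x)

theorem logInv_pos {x : ℝ} (hx : x ≠ 0) : 0 < logInv x :=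
  Real.log_pos (by linarith [abs_pos.2 (inv_ne_zero hx)])

theorem exp_logInv (x : ℝ) : Real.exp (logInv x) = 1 + |x⁻¹| :=
  Real.exp_log (by positivity)

theorem f_of_ne_zero {ρ σ x : ℝ} (hx : x ≠ 0) :
    f ρ σ x = Real.exp (-ρ * omega σ (logInv x)) := by
  simp [f, hx, g, logInv]

theorem f_eq {ρ σ x : ℝ} (hσ : 1 < σ) (hx : x ≠ 0) :
    f ρ σ x = Real.exp (-ρ * (lambertLogInv x * Real.exp (σ / (σ - 1) * lambertLogInv x))) := by
  rw [f_of_ne_zero hx, omega_eq hσ (logInv_pos hx), lambertLogInv]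

/-- The sign of a real number, as a real number. -/
noncomputable def sgn (x : ℝ) : ℝ := (SignType.sign x : ℝ)

theorem hasDerivAt_sgn {x : ℝ} (hx : x ≠ 0) : HasDerivAt sgn 0 x := by
  rcases lt_or_gt_of_ne hx with h | h
  · refine (hasDerivAt_const x (-1 : ℝ)).congr_of_eventuallyEq ?_
    filter_upwards [eventually_lt_nhds h] with y hy
    simp [sgn, hy]
  · refine (hasDerivAt_const x (1 : ℝ)).congr_of_eventuallyEq ?_
    filter_upwards [eventually_gt_nhds h] with y hy
    simp [sgn, hy]

theorem abs_sgn_le_one (x : ℝ) : |sgn x| ≤ 1 := by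
  rcases lt_trichotomy x 0 with h | h | h <;> simp [sgn, h]

theorem sgn_inv (x : ℝ) : sgn x⁻¹ = sgn x := by
  rcases lt_trichotomy x 0 with h | h | h <;> simp [sgn, h, inv_lt_zero.2]

theorem hasDerivAt_one_add_abs_inv {x : ℝ} (hx : x ≠ 0) :
    HasDerivAt (fun x : ℝ => 1 + |x⁻¹|) (-(sgn x * x⁻¹ ^ 2)) x := by
  have h := ((hasDerivAt_abs (inv_ne_zero hx)).comp x (hasDerivAt_inv hx)).const_add 1
  refine h.congr_deriv ?_
  have h2 : ((SignType.sign x⁻¹ : SignType) : ℝ) = sgn x := by rw [← sgn_inv]; rfl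
  rw [h2, inv_pow]
  ring

theorem hasDerivAt_inv_one_add_abs_inv {x : ℝ} (hx : x ≠ 0) :
    HasDerivAt (fun x : ℝ => (1 + |x⁻¹|)⁻¹) (sgn x * x⁻¹ ^ 2 * (1 + |x⁻¹|)⁻¹ ^ 2) x := by
  have h := (hasDerivAt_one_add_abs_inv hx).inv (by positivity)
  refine h.congr_deriv ?_
  simp only [neg_neg, div_eq_mul_inv, inv_pow]

theorem hasDerivAt_logInv {x : ℝ} (hx : x ≠ 0) :
    HasDerivAt logInv (-(sgn x * x⁻¹ ^ 2 * (1 + |x⁻¹|)⁻¹)) x := by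
  have h := (hasDerivAt_one_add_abs_inv hx).log (by positivity)
  refine h.congr_deriv ?_
  rw [div_eq_mul_inv, neg_mul]

theorem hasDerivAt_lambertLogInv {x : ℝ} (hx : x ≠ 0) :
    HasDerivAt lambertLogInv (-(sgn x * x⁻¹ ^ 2 * (1 + |x⁻¹|)⁻¹ *
      Real.exp (-lambertLogInv x) * (1 + lambertLogInv x)⁻¹)) x := by
  have h := (hasDerivAt_lambertW (logInv_pos hx)).comp x (hasDerivAt_logInv hx)
  refine h.congr_deriv ?_
  rw [lambertLogInv]
  ring

/-- Generators of a differential algebra containing the logarithmic derivative of `f`. -/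
noncomputable def generators (σ : ℝ) : Set (ℝ → ℝ) :=
  {fun x => x⁻¹, fun x => (1 + |x⁻¹|)⁻¹, sgn, lambertLogInv,
    fun x => Real.exp (-lambertLogInv x), fun x => (1 + lambertLogInv x)⁻¹,
    fun x => Real.exp (σ / (σ - 1) * lambertLogInv x)}

theorem lambertLogInv_pos {x : ℝ} (hx : x ≠ 0) : 0 < lambertLogInv x :=
  lambertW_pos (logInv_pos hx)

theorem one_le_conj {σ : ℝ} (hσ : 1 < σ) : 1 ≤ σ / (σ - 1) := by
  rw [one_le_div (by linarith)]; linarith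

/-- One envelope serves all generators because `u ≤ Y ≤ e^Y`, `1/|x| ≤ e^Y` and `λ ≥ 1`. -/
theorem abs_generator_le {σ : ℝ} (hσ : 1 < σ) {x : ℝ} (hx : x ≠ 0) :
    ∀ X ∈ generators σ, |X x| ≤ Real.exp (σ / (σ - 1) * logInv x) := by
  have hY := logInv_pos hx
  have hu := lambertLogInv_pos hx
  have hl := one_le_conj hσ
  have huY : lambertLogInv x ≤ logInv x := lambertW_le_self hY
  have h1 : Real.exp (logInv x) ≤ Real.exp (σ / (σ - 1) * logInv x) :=
    Real.exp_le_exp.2 (by nlinarith)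
  have h2 : 1 ≤ Real.exp (logInv x) := Real.one_le_exp hY.le
  have h3 : logInv x ≤ Real.exp (logInv x) := by linarith [Real.add_one_le_exp (logInv x)]
  rintro X (rfl | rfl | rfl | rfl | rfl | rfl | rfl)
  · refine le_trans ?_ h1
    rw [exp_logInv]; linarith
  · refine le_trans ?_ (h2.trans h1)
    rw [abs_inv]
    exact inv_le_one_of_one_le₀ (by rw [abs_of_pos (by positivity)]; linarith [abs_nonneg x⁻¹])
  · exact (abs_sgn_le_one x).trans (h2.trans h1)
  · rw [abs_of_pos hu]
    exact huY.trans (h3.trans h1)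
  · rw [Real.abs_exp]
    exact (Real.exp_le_one_iff.2 (by linarith)).trans (h2.trans h1)
  · refine le_trans ?_ (h2.trans h1)
    rw [abs_inv]
    exact inv_le_one_of_one_le₀ (by rw [abs_of_pos (by positivity)]; linarith)
  · rw [Real.abs_exp]
    exact Real.exp_le_exp.2 (by gcongr)

/-- A common bound for the coefficients of the derivatives of the generators. -/
noncomputable def coeffBound (ρ σ : ℝ) : ℝ := 1 + σ / (σ - 1) + ρ * (1 + σ / (σ - 1))

/-- The derivative of `lambertLogInv` up to sign. -/
theorem ctrl_neg_deriv_lambertLogInv (σ : ℝ) :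
    Ctrl (generators σ) 1 6 1 (fun x => sgn x * x⁻¹ ^ 2 * (1 + |x⁻¹|)⁻¹ *
      Real.exp (-lambertLogInv x) * (1 + lambertLogInv x)⁻¹) := by
  have h := ((((((Ctrl.base (𝒳 := generators σ) (φ := 1)).mul
    (X := fun x => (1 + lambertLogInv x)⁻¹) (by simp [generators])).mul
    (X := fun x => Real.exp (-lambertLogInv x)) (by simp [generators])).mul
    (X := fun x => (1 + |x⁻¹|)⁻¹) (by simp [generators])).mul
    (X := fun x => x⁻¹) (by simp [generators])).mul
    (X := fun x => x⁻¹) (by simp [generators])).mul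
    (X := sgn) (by simp [generators])
  convert h using 1
  funext x
  simp only [Pi.mul_apply, Pi.one_apply]
  ring

/-- Since `u'` has degree `6`, the largest degree is that of `((1+u)⁻¹)'`, namely `8`; the
logarithmic derivative of `f` needs `8` as well. -/
theorem generators_deriv {ρ σ : ℝ} (hσ : 1 < σ) (hρ : 0 < ρ) :
    ∀ X ∈ generators σ, ∃ Z, Ctrl (generators σ) 1 8 (coeffBound ρ σ) Z ∧
      ∀ x ∈ ({0}ᶜ : Set ℝ), HasDerivAt X (Z x) x := by
  have hl := one_le_conj hσ
  have hρl : 0 ≤ ρ * (1 + σ / (σ - 1)) := by positivity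
  have hN1 : 1 ≤ coeffBound ρ σ := by unfold coeffBound; linarith
  have hNl : σ / (σ - 1) ≤ coeffBound ρ σ := by unfold coeffBound; linarith
  have hU := ctrl_neg_deriv_lambertLogInv σ
  have hone := Ctrl.base (𝒳 := generators σ) (φ := 1)
  rintro X (rfl | rfl | rfl | rfl | rfl | rfl | rfl)
  · refine ⟨_, (((hone.mul (X := fun x => x⁻¹) (by simp [generators])).mul
      (X := fun x => x⁻¹) (by simp [generators])).smul (-1)).mono (by norm_num)
      (by simpa using hN1), fun x hx => (hasDerivAt_inv hx).congr_deriv ?_⟩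
    simp only [Pi.smul_apply, Pi.mul_apply, Pi.one_apply, smul_eq_mul]
    ring
  · refine ⟨_, (((((hone.mul
      (X := fun x => (1 + |x⁻¹|)⁻¹) (by simp [generators])).mul
      (X := fun x => (1 + |x⁻¹|)⁻¹) (by simp [generators])).mul
      (X := fun x => x⁻¹) (by simp [generators])).mul
      (X := fun x => x⁻¹) (by simp [generators])).mul
      (X := sgn) (by simp [generators])).mono (by norm_num) hN1,
      fun x hx => (hasDerivAt_inv_one_add_abs_inv hx).congr_deriv ?_⟩
    simp only [Pi.mul_apply, Pi.one_apply]
    ring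
  · refine ⟨_, (hone.smul 0).mono (by norm_num) (by simp; linarith),
      fun x hx => (hasDerivAt_sgn hx).congr_deriv ?_⟩
    simp
  · refine ⟨_, (hU.smul (-1)).mono (by norm_num) (by simpa using hN1),
      fun x hx => (hasDerivAt_lambertLogInv hx).congr_deriv ?_⟩
    simp
  · refine ⟨_, (hU.mul (X := fun x => Real.exp (-lambertLogInv x))
      (by simp [generators])).mono (by norm_num) hN1,
      fun x hx => (hasDerivAt_lambertLogInv hx).neg.exp.congr_deriv ?_⟩
    simp
  · refine ⟨_, ((hU.mul (X := fun x => (1 + lambertLogInv x)⁻¹)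
      (by simp [generators])).mul (X := fun x => (1 + lambertLogInv x)⁻¹)
      (by simp [generators])).mono (by norm_num) hN1, fun x hx =>
      (((hasDerivAt_lambertLogInv hx).const_add 1).inv
        (by linarith [lambertLogInv_pos hx])).congr_deriv ?_⟩
    simp only [Pi.mul_apply, neg_neg, div_eq_mul_inv]
    rw [← inv_pow]
    ring
  · refine ⟨_, ((hU.mul (X := fun x => Real.exp (σ / (σ - 1) * lambertLogInv x))
      (by simp [generators])).smul (-(σ / (σ - 1)))).mono (by norm_num)
      (by rwa [mul_one, abs_neg, abs_of_pos (by linarith)]), fun x hx =>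
      (((hasDerivAt_lambertLogInv hx).const_mul (σ / (σ - 1))).exp).congr_deriv ?_⟩
    simp only [Pi.smul_apply, Pi.mul_apply, smul_eq_mul]
    ring

theorem f_deriv {ρ σ : ℝ} (hσ : 1 < σ) (hρ : 0 < ρ) :
    ∃ L, Ctrl (generators σ) 1 8 (coeffBound ρ σ) L ∧
      ∀ x ∈ ({0}ᶜ : Set ℝ), HasDerivAt (f ρ σ) (L x * f ρ σ x) x := by
  have hl := one_le_conj hσ
  have hU := ctrl_neg_deriv_lambertLogInv σ
  have hUE := hU.mul (X := fun x => Real.exp (σ / (σ - 1) * lambertLogInv x))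
      (by simp [generators])
  have hUEu := hUE.mul (X := lambertLogInv) (by simp [generators])
  refine ⟨_, (((hUE.mono (Nat.le_succ _) le_rfl).add (hUEu.smul (σ / (σ - 1)))).smul ρ).mono
    le_rfl ?_, fun x hx => ?_⟩
  · rw [abs_of_pos hρ, abs_of_pos (by linarith), coeffBound]
    linarith
  · have hd := hasDerivAt_lambertLogInv hx
    have h := ((hd.mul (hd.const_mul (σ / (σ - 1))).exp).const_mul (-ρ)).exp
    have h2 : f ρ σ =ᶠ[𝓝 x] fun x => Real.exp
        (-ρ * (lambertLogInv x * Real.exp (σ / (σ - 1) * lambertLogInv x))) := by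
      filter_upwards [isOpen_ne.mem_nhds hx] with y hy using f_eq hσ hy
    refine (h.congr_of_eventuallyEq h2).congr_deriv ?_
    rw [f_eq hσ hx]
    simp only [Pi.smul_apply, Pi.mul_apply, Pi.add_apply, smul_eq_mul]
    ring

/-! ### Smoothness and flatness at the origin -/

variable {ρ σ : ℝ}

theorem abs_f {x : ℝ} (hx : x ≠ 0) : |f ρ σ x| = Real.exp (-ρ * omega σ (logInv x)) := by
  rw [f_of_ne_zero hx, Real.abs_exp]

theorem f_zero (ρ σ : ℝ) : f ρ σ 0 = 0 := by simp [f]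

theorem Ctrl.abs_le_exp (hσ : 1 < σ) {m : ℕ} {B : ℝ} {F : ℝ → ℝ}
    (h : Ctrl (generators σ) (f ρ σ) m B F) {x : ℝ} (hx : x ≠ 0) :
    |F x| ≤ B * Real.exp (m * (σ / (σ - 1)) * logInv x - ρ * omega σ (logInv x)) := by
  have hl := one_le_conj hσ
  have h1 := h.abs_le (x := x) (Real.one_le_exp (x := σ / (σ - 1) * logInv x)
    (mul_nonneg (by linarith) (logInv_pos hx).le)) (abs_generator_le hσ hx)
  refine h1.trans_eq ?_
  rw [abs_f hx, ← Real.exp_nat_mul, mul_assoc, ← Real.exp_add]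
  congr 2
  ring

theorem exp_neg_logInv_le {x : ℝ} (hx : x ≠ 0) : Real.exp (-logInv x) ≤ |x| := by
  rw [Real.exp_neg, exp_logInv, abs_inv]
  exact inv_le_of_inv_le₀ (abs_pos.2 hx) (by linarith)

/-- As `e^{-Y} ≤ |x|`, a factor `x²` is gained by applying the Legendre bound with exponent `mλ + 2`
instead of `mλ`. -/
theorem Ctrl.exists_abs_le_sq (hσ : 1 < σ) (hρ : 0 < ρ) {m : ℕ} {B : ℝ} {F : ℝ → ℝ}
    (h : Ctrl (generators σ) (f ρ σ) m B F) : ∃ C, ∀ x, |F x| ≤ C * x ^ 2 := by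
  have hl := one_le_conj hσ
  have hn : 0 < m * (σ / (σ - 1)) + 2 := by positivity
  set n := m * (σ / (σ - 1)) + 2 with hn_def
  set D := max 0 ((σ - 1) * ρ * (n / ρ) ^ σ * Real.log (n / ρ))
  refine ⟨B * Real.exp D, fun x => ?_⟩
  rcases eq_or_ne x 0 with rfl | hx
  · simp [h.eq_zero (f_zero ρ σ)]
  · have h1 := mul_sub_omega_le hσ hρ hn (logInv_pos hx)
    have hB := h.nonneg
    calc |F x| ≤ B * Real.exp (m * (σ / (σ - 1)) * logInv x - ρ * omega σ (logInv x)) :=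
          h.abs_le_exp hσ hx
      _ ≤ B * Real.exp (D + (2 : ℕ) * -logInv x) := by
          gcongr
          push_cast
          linarith
      _ = B * Real.exp D * Real.exp (-logInv x) ^ 2 := by
          rw [Real.exp_add, Real.exp_nat_mul, mul_assoc]
      _ ≤ B * Real.exp D * |x| ^ 2 := by
          gcongr
          exact exp_neg_logInv_le hx
      _ = _ := by rw [sq_abs]

theorem hasDerivAt_zero_of_abs_le_sq {F : ℝ → ℝ} {C : ℝ} (h : ∀ x, |F x| ≤ C * x ^ 2) :
    HasDerivAt F 0 0 := by
  have h0 : F 0 = 0 := by simpa using h 0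
  have hO : F =O[𝓝 0] fun x => x ^ 2 :=
    Asymptotics.IsBigO.of_bound C (Eventually.of_forall fun x => by
      simpa using h x)
  rw [hasDerivAt_iff_isLittleO]
  simpa [h0] using hO.trans_isLittleO (Asymptotics.isLittleO_pow_id (𝕜 := ℝ) one_lt_two)

/-- The derivative formula off `0` extends to `0`, where both the derivative and the formula give
`0`. -/
theorem Ctrl.exists_hasDerivAt_f (hσ : 1 < σ) (hρ : 0 < ρ) {m : ℕ} {B : ℝ} {F : ℝ → ℝ}
    (h : Ctrl (generators σ) (f ρ σ) m B F) :
    ∃ F', Ctrl (generators σ) (f ρ σ) (m + 8) (coeffBound ρ σ * (m + 1) * B) F' ∧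
      ∀ x, HasDerivAt F (F' x) x := by
  obtain ⟨L, hL, hLd⟩ := f_deriv hσ hρ
  obtain ⟨F', hF', hd⟩ := Ctrl.exists_hasDerivAt (generators_deriv hσ hρ) hL hLd h
  refine ⟨F', hF', fun x => ?_⟩
  rcases eq_or_ne x 0 with rfl | hx
  · obtain ⟨C, hC⟩ := h.exists_abs_le_sq hσ hρ
    rw [hF'.eq_zero (f_zero ρ σ)]
    exact hasDerivAt_zero_of_abs_le_sq hC
  · exact hd x hx

theorem ctrl_iteratedDeriv_f (hσ : 1 < σ) (hρ : 0 < ρ) (p : ℕ) :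
    Ctrl (generators σ) (f ρ σ) (8 * p) ((9 * coeffBound ρ σ) ^ p * p.factorial)
      (iteratedDeriv p (f ρ σ)) := by
  induction p with
  | zero => simpa using Ctrl.base
  | succ p ih =>
    obtain ⟨F', hF', hd⟩ := ih.exists_hasDerivAt_f hσ hρ
    have hN : 0 ≤ coeffBound ρ σ := by
      have := one_le_conj hσ
      unfold coeffBound
      positivity
    rw [iteratedDeriv_succ, show deriv (iteratedDeriv p (f ρ σ)) = F' from
      funext fun x => (hd x).deriv]
    refine hF'.mono (by omega) ?_
    rw [Nat.factorial_succ]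
    push_cast
    -- From `8p + 1 ≤ 9(p + 1)`, each differentiation contributes a factor `9N(p+1)`.
    calc coeffBound ρ σ * (8 * p + 1) * ((9 * coeffBound ρ σ) ^ p * p.factorial)
        ≤ coeffBound ρ σ * (9 * (p + 1)) * ((9 * coeffBound ρ σ) ^ p * p.factorial) := by
          gcongr
          linarith [(Nat.cast_nonneg p : (0 : ℝ) ≤ p)]
      _ = _ := by ring

theorem contDiff_f (hσ : 1 < σ) (hρ : 0 < ρ) : ContDiff ℝ ∞ (f ρ σ) :=
  contDiff_of_differentiable_iteratedDeriv fun p _ x =>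
    let ⟨_, _, hd⟩ := (ctrl_iteratedDeriv_f hσ hρ p).exists_hasDerivAt_f hσ hρ
    (hd x).differentiableAt

theorem iteratedDeriv_f_zero (hσ : 1 < σ) (hρ : 0 < ρ) (p : ℕ) :
    iteratedDeriv p (f ρ σ) 0 = 0 :=
  (ctrl_iteratedDeriv_f hσ hρ p).eq_zero (f_zero ρ σ)

/-! ### Membership in the extended Gevrey class -/

theorem M_eq_exp {τ : ℝ} {p : ℕ} (hp : p ≠ 0) :
    M τ σ p = Real.exp (τ * (p : ℝ) ^ σ * Real.log p) := by
  rw [M, if_neg hp, Real.rpow_def_of_pos (by positivity), mul_comm]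

theorem f_mem_classSigma (hσ : 1 < σ) (hρ : 0 < ρ) : f ρ σ ∈ classSigma σ := by
  have hl := one_le_conj hσ
  have hs : 0 < σ - 1 := by linarith
  have hN : 1 ≤ coeffBound ρ σ := by
    have : 0 ≤ ρ * (1 + σ / (σ - 1)) := by positivity
    unfold coeffBound
    linarith
  -- The Legendre bound is used with `n = 8pλ = κρp`, which yields `A p^σ ln(κp)`. In `τ = 1 + A`
  -- the `1` absorbs `p! ≤ p^p`; the terms without `ln p` go into `c`. The constants do not depend
  -- on `K`.
  set κ := 8 * (σ / (σ - 1)) / ρ with hκ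
  have hκ0 : 0 < κ := by positivity
  set A := (σ - 1) * ρ * κ ^ σ with hA
  have hA0 : 0 < A := by positivity
  set c := Real.log (9 * coeffBound ρ σ) + A * |Real.log κ| with hc
  have hc0 : 0 ≤ Real.log (9 * coeffBound ρ σ) := Real.log_nonneg (by linarith)
  have hc1 : 0 ≤ c := by positivity
  refine Set.mem_iUnion₂.2 ⟨1 + A, Set.mem_Ioi.2 (by linarith), contDiff_f hσ hρ,
    fun K _ => ⟨Real.exp c, Real.exp_pos _, fun p x _ => ?_⟩⟩
  have hM : 0 ≤ M (1 + A) σ p := by unfold M; split_ifs <;> positivity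
  have hCtrl := ctrl_iteratedDeriv_f hσ hρ p
  rcases eq_or_ne x 0 with rfl | hx
  · rw [iteratedDeriv_f_zero hσ hρ, abs_zero]
    positivity
  have hY := logInv_pos hx
  rw [← Real.exp_mul]
  rcases eq_or_ne p 0 with rfl | hp
  · have h1 := hCtrl.abs_le_exp hσ hx
    have h2 : 0 ≤ omega σ (logInv x) := by
      rw [omega_eq_mul_exp hσ hY]; positivity
    refine h1.trans ?_
    have h3 : Real.exp (-(ρ * omega σ (logInv x))) ≤ 1 :=
      Real.exp_le_one_iff.2 (by have := mul_nonneg hρ.le h2; linarith)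
    have h4 : 1 ≤ Real.exp (c * ((0 : ℝ) ^ σ + 1)) := Real.one_le_exp (by positivity)
    simpa [M] using h3.trans h4
  · have hp1 : (1 : ℝ) ≤ p := by exact_mod_cast Nat.one_le_iff_ne_zero.2 hp
    have hp0 : (0 : ℝ) < p := by linarith
    have hlog : 0 ≤ Real.log p := Real.log_nonneg hp1
    have hpσ : (p : ℝ) ≤ (p : ℝ) ^ σ := by
      simpa using Real.rpow_le_rpow_of_exponent_le hp1 hσ.le
    have h1 := hCtrl.abs_le_exp hσ hx
    have hn : 0 < ((8 * p : ℕ) : ℝ) * (σ / (σ - 1)) := by push_cast; positivity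
    have h2 := mul_sub_omega_le hσ hρ hn hY
    have hnk : ((8 * p : ℕ) : ℝ) * (σ / (σ - 1)) / ρ = κ * p := by
      rw [hκ]; push_cast; ring
    rw [hnk, Real.mul_rpow hκ0.le hp0.le, Real.log_mul hκ0.ne' hp0.ne'] at h2
    have h3 : max 0 ((σ - 1) * ρ * (κ ^ σ * (p : ℝ) ^ σ) * (Real.log κ + Real.log p)) ≤
        A * |Real.log κ| * (p : ℝ) ^ σ + A * (p : ℝ) ^ σ * Real.log p := by
      refine max_le (by positivity) ?_
      have : A * (p : ℝ) ^ σ * Real.log κ ≤ A * (p : ℝ) ^ σ * |Real.log κ| := by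
        gcongr
        exact le_abs_self _
      rw [hA] at *
      linarith
    have h4 : (9 * coeffBound ρ σ) ^ p * (p.factorial : ℝ) ≤
        Real.exp (Real.log (9 * coeffBound ρ σ) * (p : ℝ) ^ σ + (p : ℝ) ^ σ * Real.log p) := by
      have h5 : (p.factorial : ℝ) ≤ (p : ℝ) ^ p := by exact_mod_cast Nat.factorial_le_pow p
      calc (9 * coeffBound ρ σ) ^ p * (p.factorial : ℝ)
          ≤ (9 * coeffBound ρ σ) ^ p * (p : ℝ) ^ p := by gcongr
        _ = Real.exp (p * Real.log (9 * coeffBound ρ σ) + p * Real.log p) := by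
          rw [Real.exp_add, Real.exp_nat_mul, Real.exp_nat_mul, Real.exp_log (by linarith),
            Real.exp_log hp0]
        _ ≤ _ := by
          refine Real.exp_le_exp.2 ?_
          rw [mul_comm (Real.log _)]
          gcongr
    rw [M_eq_exp hp, ← Real.exp_add]
    calc _ ≤ _ := h1
      _ ≤ Real.exp (Real.log (9 * coeffBound ρ σ) * (p : ℝ) ^ σ + (p : ℝ) ^ σ * Real.log p) *
          Real.exp (A * |Real.log κ| * (p : ℝ) ^ σ + A * (p : ℝ) ^ σ * Real.log p) :=
        mul_le_mul h4 (Real.exp_le_exp.2 (h2.trans h3)) (Real.exp_pos _).le (Real.exp_pos _).le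
      _ ≤ _ := by
        rw [← Real.exp_add]
        refine Real.exp_le_exp.2 ?_
        rw [hc] at *
        linarith

/-! ### Sharpness -/

/-- Taylor's estimate at a point where all derivatives vanish. -/
theorem abs_le_pow_mul_of_flat {φ : ℝ → ℝ} (hφ : ContDiff ℝ ∞ φ)
    (h0 : ∀ p, iteratedDeriv p φ 0 = 0) {p : ℕ} {D : ℝ}
    (hD : ∀ x ∈ Set.Icc (0 : ℝ) 1, |iteratedDeriv p φ x| ≤ D) :
    ∀ x ∈ Set.Icc (0 : ℝ) 1, |φ x| ≤ D * x ^ p := by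
  -- Descending from order `p` to order `0`, each mean value inequality gains one power of `x`; the
  -- Taylor factor `1/p!` is not needed.
  suffices H : ∀ k ≤ p, ∀ x ∈ Set.Icc (0 : ℝ) 1, |iteratedDeriv (p - k) φ x| ≤ D * x ^ k by
    simpa using H p le_rfl
  intro k
  induction k with
  | zero => simpa using hD
  | succ k ih =>
    intro hk x hx
    have ih := ih (by omega)
    have hD0 : 0 ≤ D := (abs_nonneg _).trans (hD 0 (by simp))
    obtain ⟨q, hq⟩ : ∃ q, p - k = q + 1 := ⟨p - (k + 1), by omega⟩
    have hq' : p - (k + 1) = q := by omega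
    rw [hq] at ih
    rw [hq']
    have hdiff : Differentiable ℝ (iteratedDeriv q φ) :=
      hφ.differentiable_iteratedDeriv q (by exact_mod_cast WithTop.coe_lt_top _)
    have := (convex_Icc (0 : ℝ) x).norm_image_sub_le_of_norm_deriv_le (f := iteratedDeriv q φ)
      (C := D * x ^ k) (x := 0) (y := x) (fun y _ => hdiff y) (fun y hy => by
        rw [← iteratedDeriv_succ, Real.norm_eq_abs]
        refine (ih y ⟨hy.1, hy.2.trans hx.2⟩).trans ?_
        have := hy.1
        gcongr
        exact hy.2) (by simp [hx.1]) (by simp [hx.1])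
    rw [h0, sub_zero, sub_zero, Real.norm_eq_abs, Real.norm_eq_abs, abs_of_nonneg hx.1] at this
    rw [pow_succ, ← mul_assoc]
    exact this

/-- This is the logarithm of Taylor's estimate at `x = 1/(e^y - 1)`, for which `logInv x = y`. The
`ln 2` comes from `x ≤ 2e^{-y}`, valid once `e^y ≥ 2`. -/
theorem logInv_bound_of_mem (hσ : 1 < σ) (hρ : 0 < ρ) {τ σ' : ℝ}
    (h : f ρ σ ∈ classTauSigma τ σ') :
    ∃ c : ℝ, ∀ p : ℕ, p ≠ 0 → ∀ y : ℝ, Real.log 2 ≤ y →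
      p * (y - Real.log 2) ≤
        ρ * omega σ y + c * ((p : ℝ) ^ σ' + 1) + τ * (p : ℝ) ^ σ' * Real.log p := by
  obtain ⟨C, hC, hb⟩ := h.2 (Set.Icc 0 1) isCompact_Icc
  refine ⟨Real.log C, fun p hp y hy => ?_⟩
  have hy0 : 0 < y := (Real.log_pos one_lt_two).trans_le hy
  have h2y : 2 ≤ Real.exp y := (Real.log_le_iff_le_exp two_pos).1 hy
  set x := (Real.exp y - 1)⁻¹ with hx
  have hx0 : 0 < x := inv_pos.2 (by linarith)
  have hx1 : x ≤ 1 := inv_le_one_of_one_le₀ (by linarith)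
  have hY : logInv x = y := by
    rw [logInv, abs_of_pos (inv_pos.2 hx0), hx, inv_inv, add_sub_cancel, Real.log_exp]
  have h1 := abs_le_pow_mul_of_flat h.1 (iteratedDeriv_f_zero hσ hρ) (hb p) x ⟨hx0.le, hx1⟩
  rw [abs_f hx0.ne', hY, M_eq_exp hp, Real.rpow_def_of_pos hC, ← Real.exp_add] at h1
  have h2 : x ≤ Real.exp (Real.log 2 - y) := by
    rw [Real.exp_sub, Real.exp_log two_pos, hx, inv_le_comm₀ (by linarith) (by positivity),
      inv_div]
    linarith
  have h3 : x ^ p ≤ Real.exp (p * (Real.log 2 - y)) := by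
    rw [Real.exp_nat_mul]; gcongr
  have h4 := h1.trans (mul_le_mul_of_nonneg_left h3 (Real.exp_pos _).le)
  rw [← Real.exp_add, Real.exp_le_exp] at h4
  linarith

theorem f_notMem_classTauSigma (hσ : 1 < σ) (hρ : 0 < ρ) {τ σ' : ℝ} (hσ'1 : 1 ≤ σ')
    (hσ' : σ' < σ) : f ρ σ ∉ classTauSigma τ σ' := by
  intro hmem
  obtain ⟨c, hc⟩ := logInv_bound_of_mem hσ hρ hmem
  have hs : 0 < σ - 1 := by linarith
  have h4 : 0 < 4 * ρ := by positivity
  -- `K` sums the coefficients of `R ln p` that bound the three error terms below; `c₀` is the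
  -- constant of the lower bound, with `3/8 = 3/4 · 1/2`.
  set K := 1 + 2 * |c| + |τ| with hK
  set c₀ := 3 / 8 * (σ - 1) / (4 * ρ) ^ (σ - 1) with hc₀
  have hc₀0 : 0 < c₀ := by positivity
  obtain ⟨p, ⟨hpK, hp1, hp2, hp3⟩, hp⟩ :
      ∃ p : ℕ, (K / c₀ < (p : ℝ) ^ (σ - σ') ∧ 1 ≤ Real.log p ∧ 2 * Real.log (4 * ρ) ≤ Real.log p ∧
        2 / (σ - 1) ≤ Real.log p) ∧ p ≠ 0 := by
    have ht1 := (tendsto_rpow_atTop (sub_pos.2 hσ')).comp (tendsto_natCast_atTop_atTop (R := ℝ))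
    have ht2 := Real.tendsto_log_atTop.comp (tendsto_natCast_atTop_atTop (R := ℝ))
    exact (((ht1.eventually_gt_atTop _).and ((ht2.eventually_ge_atTop _).and
      ((ht2.eventually_ge_atTop _).and (ht2.eventually_ge_atTop _)))).and
      (eventually_ne_atTop 0)).exists
  have hP : (1 : ℝ) ≤ p := by exact_mod_cast Nat.one_le_iff_ne_zero.2 hp
  have hP0 : (0 : ℝ) < p := by linarith
  have hq0 : 0 < (p : ℝ) / (4 * ρ) := by positivity
  have hlogq : Real.log p / 2 ≤ Real.log (p / (4 * ρ)) := by
    rw [Real.log_div hP0.ne' h4.ne']; linarith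
  -- The test point is `y = w e^w`: then `e^{W(y)/(σ-1)} = p/(4ρ)`, so `ρω(y) = py/4` and three
  -- quarters of `py` remain.
  set w := (σ - 1) * Real.log (p / (4 * ρ)) with hw
  have hwp : (σ - 1) * (Real.log p / 2) ≤ w := mul_le_mul_of_nonneg_left hlogq hs.le
  have hw1 : 1 ≤ w := by
    rw [div_le_iff₀ hs] at hp3
    linarith
  have hexp : Real.exp w = (p : ℝ) ^ (σ - 1) / (4 * ρ) ^ (σ - 1) := by
    rw [hw, mul_comm, ← Real.rpow_def_of_pos hq0, Real.div_rpow hP0.le h4.le]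
  have homega : ρ * omega σ (w * Real.exp w) = p * (w * Real.exp w) / 4 := by
    rw [omega_eq_mul_exp hσ (by positivity), lambertW_mul_exp (by linarith), hw,
      mul_div_cancel_left₀ _ hs.ne', Real.exp_log hq0]
    field_simp
  have hl2 : Real.log 2 ≤ 1 := by linarith [Real.log_two_lt_d9]
  have hy : Real.log 2 ≤ w * Real.exp w := by
    have := Real.one_le_exp (zero_le_one.trans hw1)
    nlinarith
  have hmain := hc p hp _ hy
  rw [homega] at hmain
  set R := (p : ℝ) ^ σ' with hR
  have hPR : (p : ℝ) ≤ R := by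
    simpa using Real.rpow_le_rpow_of_exponent_le hP hσ'1
  have hR0 : 0 < R := by linarith
  have hRl : R ≤ R * Real.log p := le_mul_of_one_le_right hR0.le hp1
  have b1 : p * Real.log 2 ≤ R * Real.log p := by
    have : p * Real.log 2 ≤ p * 1 := by gcongr
    linarith
  have b2 : c * (R + 1) ≤ 2 * |c| * (R * Real.log p) := by
    calc c * (R + 1) ≤ |c| * (2 * (R * Real.log p)) := by
          gcongr
          · exact le_abs_self c
          · linarith
      _ = _ := by ring
  have b3 : τ * R * Real.log p ≤ |τ| * (R * Real.log p) := by
    rw [mul_assoc]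
    gcongr
    exact le_abs_self τ
  have hup : 3 / 4 * (p * (w * Real.exp w)) ≤ K * (R * Real.log p) := by
    rw [hK]; linarith
  have hlow : c₀ * (p : ℝ) ^ σ * Real.log p ≤ 3 / 4 * (p * (w * Real.exp w)) := by
    calc c₀ * (p : ℝ) ^ σ * Real.log p
        = 3 / 4 * (p * ((σ - 1) * (Real.log p / 2) * Real.exp w)) := by
          rw [hexp, hc₀, show (p : ℝ) ^ σ = p ^ (σ - 1) * p by
            rw [← Real.rpow_add_one hP0.ne']; ring_nf]
          ring
      _ ≤ _ := by gcongr
  have hfin : c₀ * (p : ℝ) ^ σ ≤ K * R :=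
    le_of_mul_le_mul_right (by linarith) (zero_lt_one.trans_le hp1)
  rw [div_lt_iff₀ hc₀0, Real.rpow_sub hP0, ← hR, div_mul_eq_mul_div, lt_div_iff₀ hR0] at hpK
  linarith

end ExtendedGevrey

theorem proposition2p12 (σ : ℝ) (hσ : 1 < σ) (ρ : ℝ) (hρ : 0 < ρ) :
    (ExtendedGevrey.f ρ σ ∈ ExtendedGevrey.classSigma σ \
        (⋃ σ' ∈ Set.Ioo (1 : ℝ) σ, ExtendedGevrey.classSigma σ')) ∧
      ExtendedGevrey.f ρ σ ∉ ⋃ t ∈ Set.Ioi (1 : ℝ), ExtendedGevrey.gevreyClass t := by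
  refine ⟨⟨ExtendedGevrey.f_mem_classSigma hσ hρ, fun h => ?_⟩, fun h => ?_⟩
  · obtain ⟨σ', hσ', h⟩ := Set.mem_iUnion₂.1 h
    obtain ⟨τ, _, h⟩ := Set.mem_iUnion₂.1 h
    exact ExtendedGevrey.f_notMem_classTauSigma hσ hρ hσ'.1.le hσ'.2 h
  · obtain ⟨t, _, h⟩ := Set.mem_iUnion₂.1 h
    exact ExtendedGevrey.f_notMem_classTauSigma hσ hρ le_rfl hσ h
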